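/- **Proposition 9.4.** Let $M=\Gamma\backslash\mathbb H$ be a closed hyperbolic surface, where $\Gamma<\mathrm{SL}_2(\mathbb R)$ is a discrete subgroup, possibly containing $-I$, such that no element of $\Gamma\setminus\{\pm I\}$ fixes a point of the upper half-plane $\mathbb H$ and the quotient $\Gamma\backslash\mathbb H$ is compact. For $\gamma\in\Gamma\setminus\{\pm I\}$ let $\ell_\gamma$ denote the hyperbolic length of the closed geodesic of $M$ corresponding to the conjugacy class of $\gamma$, that is, the distance by which $\gamma$ translates its axis in $\mathbb H$ (so $\ell_{\gamma^k}=k\,\ell_\gamma$ for $k\ge 1$). Let $f:\Gamma\to\mathbb Z$ be constant on conjugacy classes and a quasimorphism with defect $D$, meaning $$|f(\gamma_1\gamma_2)-f(\gamma_1)-f(\gamma_2)|\le D\qquad\text{for all }\gamma_1,\gamma_2\in\Gamma .$$ Then $$|f(\gamma)|\ \ll\ (1+D)\,\ell_\gamma\qquad\text{for all }\gamma\in\Gamma\setminus\{\pm I\},$$ where the implied constant depends only on $\Gamma$ and on $f$, and on $f$ only through a bound for its values on a finite generating set. Precisely: $\Gamma$ is finitely generated, and for every finite generating set $S$ of $\Gamma$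 and every $M_0\in\mathbb{R}$ there is a constant $K>0$ such that every integer-valued conjugacy-invariant quasimorphism $f$ on $\Gamma$ of defect $D$ with $\max_{s\in S}|f(s)|\le M_0$ satisfies $|f(\gamma)|\le K(1+D)\,\ell_\gamma$ for all $\gamma\in\Gamma\setminus\{\pm I\}$. -/

import Mathlib

open scoped MatrixGroups UpperHalfPlane

/-- `M = Γ \ ℍ` is a closed (compact, without boundary, oriented) hyperbolic surface: `Γ` is a
discrete subgroup of `SL(2, ℝ)`, its image in `PSL(2, ℝ)` acts freely on the upper half-plane
(so that the quotient is a surface and not merely an orbifold), and the quotient is compact.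
The group `Γ` may or may not contain `-I`. -/
structure IsClosedHyperbolicSurfaceGroup (Γ : Subgroup SL(2, ℝ)) : Prop where
  discrete : DiscreteTopology Γ
  free : ∀ γ ∈ Γ, ∀ z : ℍ, γ • z = z → γ = 1 ∨ γ = -1
  compact : CompactSpace (MulAction.orbitRel.Quotient Γ ℍ)

/-- `γ` translates some unit-speed complete geodesic `c` of the hyperbolic plane (an isometric
embedding of the real line) by `ℓ > 0`. The image of `c` in the quotient is then the closed geodesic
corresponding to the conjugacy class of `γ`, and `ℓ` is its length (a power `γ ^ k` corresponds to
the closed geodesic of `γ` run through `k` times). -/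
def TranslatesGeodesicBy (γ : SL(2, ℝ)) (ℓ : ℝ) : Prop :=
  0 < ℓ ∧ ∃ c : ℝ → ℍ, Isometry c ∧ ∀ t : ℝ, γ • c t = c (t + ℓ)

/-- The length `ℓ_γ` of the closed geodesic corresponding to `γ`. The set below has exactly one
element when `γ` is hyperbolic, and is empty otherwise. -/
noncomputable def closedGeodesicLength (γ : SL(2, ℝ)) : ℝ :=
  sInf {ℓ : ℝ | TranslatesGeodesicBy γ ℓ}

/-- `f` is a quasimorphism with defect (at most) `D`. -/
def IsQuasimorphismWithDefect {G : Type*} [Group G] (f : G → ℝ) (D : ℝ) : Prop :=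
  ∀ a b : G, |f (a * b) - f a - f b| ≤ D

/-- `f` is constant on conjugacy classes. -/
def IsConjugacyInvariant {G α : Type*} [Group G] (f : G → α) : Prop :=
  ∀ a b : G, f (a * b * a⁻¹) = f b

/-!
The bound is the Švarc–Milnor lemma combined with the positivity of the systole.

Since the quotient is compact, every point of `ℍ` is within some distance `R` of the orbit of `i`.
Walking along the geodesic from `i` to `γ • i` writes `γ` as a product of about `dist i (γ • i)`
elements of the set `T` of those `t` with `dist i (t • i) ≤ 2 * R + 1` (`orbit_dist_induction`), and
`T` is finite by proper discontinuity. So `T` generates `Γ`, and since each element of `T` is a fixed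
word in any given generating set, every quasimorphism satisfies
`|f γ| ≤ C * (1 + D) * (dist i (γ • i) + 2)` (`exists_quasimorphism_bound_dist`).

If `γ` translates a geodesic by `l`, a conjugate of `γ` does so along a geodesic passing within `R` of
`i`, and hence moves `i` by at most `l + 2 * R`; conjugation does not change `f γ`. The additive
constant is absorbed because the displacement of `γ ≠ ±1` is bounded below by some `ε > 0`
(`exists_displacement_lower_bound`).

As `closedGeodesicLength` is an infimum, it must also be shown that `γ ≠ ±1` does translate some
geodesic. If `|trace γ| > 2`, diagonalizing `γ` gives its axis (`exists_translatesGeodesicBy`).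
Otherwise `γ` has points of arbitrarily small displacement (`exists_cosh_dist_smul_le`), which the
lower bound `ε` excludes.
-/

/-! ### Cocompact isometric actions -/

section Action

variable {G X : Type*} [Group G] [PseudoMetricSpace X] [MulAction G X] [IsIsometricSMul G X]

/-- Induction along geodesics for an isometric action with coarsely dense orbit of `o`. If `g • o` is
farther than `2 * R + 1` from `o`, the point at distance `R + 1` before `g • o` on a geodesic from `o`
is `R`-close to some `g' • o`; then `g' • o` is nearer to `o` than `g • o` by at least `1`, and `g`
differs from `g'` by an element moving `o` by at most `2 * R + 1`. The index `n` in `P n g` plays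
the role of a word length. -/
theorem orbit_dist_induction {o : X} {R : ℝ} (hR : 0 ≤ R)
    (hcov : ∀ x : X, ∃ g : G, dist x (g • o) ≤ R)
    (hgeo : ∀ (y : X) (r : ℝ), 0 ≤ r → r ≤ dist o y →
      ∃ p : X, dist o p ≤ dist o y - r ∧ dist p y ≤ r)
    {P : ℕ → G → Prop}
    (base : ∀ n g, dist o (g • o) ≤ 2 * R + 1 → P n g)
    (step : ∀ n g t, P n g → dist o (t • o) ≤ 2 * R + 1 → P (n + 1) (g * t)) :
    ∀ (n : ℕ) (g : G), dist o (g • o) ≤ n → P n g := by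
  intro n
  induction n with
  | zero => intro g hg; exact base 0 g (hg.trans (by push_cast; positivity))
  | succ n ih =>
    intro γ hγ
    rcases le_or_gt (dist o (γ • o)) (2 * R + 1) with h | h
    · exact base _ _ h
    obtain ⟨p, hp, hpγ⟩ := hgeo (γ • o) (R + 1) (by positivity) (by linarith)
    obtain ⟨g, hg⟩ := hcov p
    have h1 : dist o (g • o) ≤ n := by
      push_cast at hγ
      linarith [dist_triangle o p (g • o)]
    have h2 : dist o ((g⁻¹ * γ) • o) ≤ 2 * R + 1 := by
      rw [← dist_smul g o, mul_smul, smul_inv_smul]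
      linarith [dist_triangle (g • o) p (γ • o), dist_comm p (g • o)]
    simpa using step n g (g⁻¹ * γ) (ih g h1) h2

/-- A cocompact action has `R`-dense orbits for some `R`: the images of the balls about `o` form an
increasing open cover of the compact quotient. -/
theorem exists_cobounded [ContinuousConstSMul G X] [CompactSpace (MulAction.orbitRel.Quotient G X)]
    (o : X) : ∃ R : ℝ, 0 ≤ R ∧ ∀ x : X, ∃ g : G, dist x (g • o) ≤ R := by
  let π : X → MulAction.orbitRel.Quotient G X := Quotient.mk _
  have hπ : IsOpenMap π := isOpenMap_quotient_mk'_mul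
  obtain ⟨n, hn⟩ := isCompact_univ.elim_directed_cover
    (fun n : ℕ => π '' Metric.ball o n) (fun n => hπ _ Metric.isOpen_ball)
    (by
      intro q _
      obtain ⟨x, rfl⟩ := Quotient.exists_rep q
      obtain ⟨n, hn⟩ := exists_nat_gt (dist x o)
      exact Set.mem_iUnion.2 ⟨n, x, hn, rfl⟩)
    (Monotone.directed_le fun m n hmn =>
      Set.image_mono (Metric.ball_subset_ball (by exact_mod_cast hmn)))
  refine ⟨n, n.cast_nonneg, fun x => ?_⟩
  obtain ⟨y, hy, hyx⟩ := hn (Set.mem_univ (π x))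
  obtain ⟨g, hg⟩ : y ∈ MulAction.orbit G x := MulAction.orbitRel_apply.1 (Quotient.exact hyx)
  refine ⟨g⁻¹, ?_⟩
  rw [← dist_smul g, smul_inv_smul]
  have : dist y o < n := hy
  simp only at hg
  rw [hg]
  exact this.le

end Action

theorem finite_setOf_dist_le {G X : Type*} [Group G] [PseudoMetricSpace X] [MulAction G X]
    [ProperSpace X] [ProperlyDiscontinuousSMul G X] (o : X) (r : ℝ) :
    {g : G | dist o (g • o) ≤ r}.Finite := by
  refine (ProperlyDiscontinuousSMul.finite_disjoint_inter_image (Γ := G)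
    (isCompact_singleton (x := o)) (isCompact_closedBall o r)).subset ?_
  intro g hg
  refine ⟨g • o, ⟨o, rfl, rfl⟩, ?_⟩
  rw [Metric.mem_closedBall, dist_comm]
  exact hg

section MetricAction

variable {G X : Type*} [Group G] [MetricSpace X] [MulAction G X] [IsIsometricSMul G X]

/-- A cocompact, properly discontinuous isometric action has displacement bounded below, away from a
conjugation-stable set `N` of elements containing all those with a fixed point. After conjugation
the point lies in a fixed compact ball, and only finitely many elements move a point of that ball by
less than `1`; each of these, if not in `N`, has positive minimal displacement on the ball. -/
theorem exists_displacement_lower_bound [ProperSpace X] [ProperlyDiscontinuousSMul G X]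
    [CompactSpace (MulAction.orbitRel.Quotient G X)] [Nonempty X]
    {N : Set G} (hN : ∀ g h : G, g * h * g⁻¹ ∈ N → h ∈ N)
    (hfree : ∀ g : G, ∀ x : X, g • x = x → g ∈ N) :
    ∃ ε : ℝ, 0 < ε ∧ ∀ g : G, g ∉ N → ∀ x : X, ε ≤ dist x (g • x) := by
  classical
  obtain ⟨o⟩ := ‹Nonempty X›
  obtain ⟨R, hR, hcov⟩ := exists_cobounded (G := G) o
  let F : Set G := {g | dist o (g • o) ≤ 2 * R + 1}
  have hF : F.Finite := finite_setOf_dist_le o _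
  have key : ∀ g : G, ∃ δ : ℝ, 0 < δ ∧
      (g ∉ N → ∀ x ∈ Metric.closedBall o R, δ ≤ dist x (g • x)) := by
    intro g
    by_cases hg : g ∈ N
    · exact ⟨1, one_pos, fun h => absurd hg h⟩
    obtain ⟨x, -, hmin⟩ := (isCompact_closedBall o R).exists_isMinOn
      ⟨o, Metric.mem_closedBall_self hR⟩
      (f := fun x => dist x (g • x)) (by fun_prop)
    exact ⟨dist x (g • x), dist_pos.2 fun h => hg (hfree g x h.symm), fun _ y hy => hmin hy⟩
  choose δ hδ hδN using key
  obtain ⟨ε, hε, hεF⟩ : ∃ ε : ℝ, 0 < ε ∧ ∀ g ∈ F, ε ≤ δ g := by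
    rcases F.eq_empty_or_nonempty with h | h
    · exact ⟨1, one_pos, by simp [h]⟩
    · obtain ⟨g, -, hmin⟩ := Set.exists_min_image F δ hF h
      exact ⟨δ g, hδ g, hmin⟩
  refine ⟨min ε 1, lt_min hε one_pos, fun h hh x => ?_⟩
  rcases le_or_gt 1 (dist x (h • x)) with h1 | h1
  · exact (min_le_right _ _).trans h1
  obtain ⟨g, hg⟩ := hcov x
  -- translate `x` into the ball of radius `R` about `o`, which conjugates `h`
  have hx : dist o (g⁻¹ • x) ≤ R := by
    rwa [← dist_smul g, smul_inv_smul, dist_comm]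
  have hd : dist (g⁻¹ • x) ((g⁻¹ * h * g⁻¹⁻¹) • g⁻¹ • x) = dist x (h • x) := by
    rw [mul_smul, inv_smul_smul, mul_smul, dist_smul]
  have hconj : g⁻¹ * h * g⁻¹⁻¹ ∈ F := by
    change dist o _ ≤ _
    have := dist_smul (g⁻¹ * h * g⁻¹⁻¹) (g⁻¹ • x) o
    have h3 := dist_triangle4 o (g⁻¹ • x) ((g⁻¹ * h * g⁻¹⁻¹) • g⁻¹ • x) ((g⁻¹ * h * g⁻¹⁻¹) • o)
    rw [hd, this, dist_comm (g⁻¹ • x) o] at h3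
    linarith
  rw [← hd]
  exact (min_le_left _ _).trans ((hεF _ hconj).trans
    (hδN _ (fun hc => hh (hN _ _ hc)) _ (by rwa [Metric.mem_closedBall, dist_comm])))

end MetricAction

/-! ### Quasimorphisms -/

section Quasimorphism

variable {G : Type*} [Group G]

theorem IsQuasimorphismWithDefect.abs_mul_le {f : G → ℝ} {D : ℝ}
    (hf : IsQuasimorphismWithDefect f D) (a b : G) : |f (a * b)| ≤ |f a| + |f b| + D := by
  have h1 := hf a b
  have h2 := abs_add_three (f (a * b) - f a - f b) (f a) (f b)
  rw [show f (a * b) - f a - f b + f a + f b = f (a * b) by ring] at h2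
  linarith

theorem IsQuasimorphismWithDefect.defect_nonneg {f : G → ℝ} {D : ℝ}
    (hf : IsQuasimorphismWithDefect f D) : 0 ≤ D :=
  (abs_nonneg _).trans (hf 1 1)

theorem IsQuasimorphismWithDefect.abs_one_le {f : G → ℝ} {D : ℝ}
    (hf : IsQuasimorphismWithDefect f D) : |f 1| ≤ D := by
  simpa using hf 1 1

theorem IsQuasimorphismWithDefect.abs_inv_le {f : G → ℝ} {D : ℝ}
    (hf : IsQuasimorphismWithDefect f D) (a : G) : |f a⁻¹| ≤ |f a| + 2 * D := by
  have h1 := hf a a⁻¹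
  rw [mul_inv_cancel] at h1
  have h2 := hf.abs_one_le
  rw [abs_le] at h1 h2
  refine abs_le.2 ⟨?_, ?_⟩ <;> linarith [le_abs_self (f a), neg_abs_le (f a)]

/-- The bound `N` depends on `g` but is uniform in the quasimorphism and its defect. -/
theorem exists_quasimorphism_bound_of_mem_closure (S : Set G) (M : ℝ) {g : G}
    (hg : g ∈ Subgroup.closure S) :
    ∃ N : ℝ, 0 ≤ N ∧ ∀ (f : G → ℝ) (D : ℝ), IsQuasimorphismWithDefect f D →
      (∀ s ∈ S, |f s| ≤ M) → |f g| ≤ N * (1 + D) := by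
  induction hg using Subgroup.closure_induction with
  | mem s hs =>
    refine ⟨max M 0, le_max_right _ _, fun f D hf hS => ?_⟩
    have := hf.defect_nonneg
    nlinarith [hS s hs, le_max_left M 0, le_max_right M 0]
  | one =>
    exact ⟨1, zero_le_one, fun f D hf _ => by linarith [hf.abs_one_le]⟩
  | mul a b _ _ iha ihb =>
    obtain ⟨A, hA, hfA⟩ := iha
    obtain ⟨B, hB, hfB⟩ := ihb
    refine ⟨A + B + 1, by positivity, fun f D hf hS => ?_⟩
    linarith [hf.abs_mul_le a b, hfA f D hf hS, hfB f D hf hS]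
  | inv a _ iha =>
    obtain ⟨A, hA, hfA⟩ := iha
    refine ⟨A + 2, by positivity, fun f D hf hS => ?_⟩
    linarith [hf.abs_inv_le a, hfA f D hf hS]

end Quasimorphism

/-- A quasimorphism grows at most linearly in the displacement of the base point, with a constant that
depends on the quasimorphism only through a bound for its values on a generating set. -/
theorem exists_quasimorphism_bound_dist {G X : Type*} [Group G] [PseudoMetricSpace X]
    [MulAction G X] [IsIsometricSMul G X] {o : X} {R : ℝ} (hR : 0 ≤ R)
    (hcov : ∀ x : X, ∃ g : G, dist x (g • o) ≤ R)
    (hgeo : ∀ (y : X) (r : ℝ), 0 ≤ r → r ≤ dist o y →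
      ∃ p : X, dist o p ≤ dist o y - r ∧ dist p y ≤ r)
    (hfin : {g : G | dist o (g • o) ≤ 2 * R + 1}.Finite)
    {S : Set G} (hS : Subgroup.closure S = ⊤) (M : ℝ) :
    ∃ C : ℝ, 0 < C ∧ ∀ (f : G → ℝ) (D : ℝ), IsQuasimorphismWithDefect f D →
      (∀ s ∈ S, |f s| ≤ M) → ∀ g : G, |f g| ≤ C * (1 + D) * (dist o (g • o) + 2) := by
  choose N hN hfN using fun g : G =>
    exists_quasimorphism_bound_of_mem_closure S M (g := g) (hS ▸ Subgroup.mem_top g)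
  obtain ⟨B, hB⟩ := (hfin.image N).bddAbove
  have hNB (g : G) (hg : dist o (g • o) ≤ 2 * R + 1) : N g ≤ B := hB ⟨g, hg, rfl⟩
  have hB0 : 0 ≤ B := (hN 1).trans (hNB 1 (by rw [one_smul, dist_self]; positivity))
  refine ⟨B + 1, by positivity, fun f D hf hfS g => ?_⟩
  have hD := hf.defect_nonneg
  have hshort (t : G) (ht : dist o (t • o) ≤ 2 * R + 1) : |f t| ≤ B * (1 + D) :=
    (hfN t f D hf hfS).trans (mul_le_mul_of_nonneg_right (hNB t ht) (by positivity))
  have hword := orbit_dist_induction hR hcov hgeo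
    (P := fun n g => |f g| ≤ (B + 1) * (1 + D) * (n + 1))
    (fun n t ht => by
      have : 0 ≤ (B + 1) * (1 + D) * n := by positivity
      linarith [hshort t ht])
    (fun n g t hg ht => by
      push_cast
      linarith [hshort t ht, hf.abs_mul_le g t])
    _ g (Nat.le_ceil _)
  refine hword.trans (mul_le_mul_of_nonneg_left ?_ (by positivity))
  linarith [Nat.ceil_lt_add_one (dist_nonneg (x := o) (y := g • o))]

/-- The generating set of the Švarc–Milnor lemma. -/
theorem closure_dist_le_eq_top {G X : Type*} [Group G] [PseudoMetricSpace X]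
    [MulAction G X] [IsIsometricSMul G X] {o : X} {R : ℝ} (hR : 0 ≤ R)
    (hcov : ∀ x : X, ∃ g : G, dist x (g • o) ≤ R)
    (hgeo : ∀ (y : X) (r : ℝ), 0 ≤ r → r ≤ dist o y →
      ∃ p : X, dist o p ≤ dist o y - r ∧ dist p y ≤ r) :
    Subgroup.closure {g : G | dist o (g • o) ≤ 2 * R + 1} = ⊤ :=
  (Subgroup.eq_top_iff' _).2 fun g =>
    orbit_dist_induction hR hcov hgeo
      (P := fun _ g => g ∈ Subgroup.closure {g : G | dist o (g • o) ≤ 2 * R + 1})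
      (fun _ _ ht => Subgroup.subset_closure ht)
      (fun _ _ _ hg ht => mul_mem hg (Subgroup.subset_closure ht)) _ g (Nat.le_ceil _)

/-! ### The hyperbolic plane -/

/-- Displacement of `z` under `g = (a b; c d)`, in terms of the quadratic polynomial
`c z ^ 2 + (d - a) z - b` whose roots are the fixed points of `g`. -/
theorem cosh_dist_smul (g : SL(2, ℝ)) (z : ℍ) :
    Real.cosh (dist z (g • z)) = 1 + Complex.normSq
      (g 1 0 * (z : ℂ) ^ 2 + (g 1 1 - g 0 0) * z - g 0 1) / (2 * z.im ^ 2) := by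
  have hden : (g 1 0 * z + g 1 1 : ℂ) ≠ 0 := UpperHalfPlane.denom_ne_zero g z
  have him : (g • z).im = z.im / Complex.normSq (g 1 0 * z + g 1 1) := by
    rw [MulAction.compHom_smul_def, UpperHalfPlane.im_smul_eq_div_normSq]
    simp [UpperHalfPlane.denom]
  have hsub : (z : ℂ) - (g • z : ℍ) =
      (g 1 0 * (z : ℂ) ^ 2 + (g 1 1 - g 0 0) * z - g 0 1) / (g 1 0 * z + g 1 1) := by
    rw [UpperHalfPlane.coe_specialLinearGroup_apply]
    simp only [Algebra.algebraMap_self, RingHom.id_apply]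
    rw [eq_div_iff hden, sub_mul, div_mul_cancel₀ _ hden]
    ring
  have h0 := Complex.normSq_pos.2 hden
  have := z.im_pos
  rw [UpperHalfPlane.cosh_dist, dist_eq_norm, hsub, ← Complex.normSq_eq_norm_sq, him,
    Complex.normSq_div]
  field_simp

/-- An element that is not hyperbolic has points of arbitrarily small displacement. -/
theorem exists_cosh_dist_smul_le {g : SL(2, ℝ)} (hg : (g 0 0 + g 1 1) ^ 2 ≤ 4) {ε : ℝ}
    (hε : 0 < ε) : ∃ z : ℍ, Real.cosh (dist z (g • z)) ≤ 1 + ε := by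
  have hdet : g 0 0 * g 1 1 - g 0 1 * g 1 0 = 1 := by
    rw [← Matrix.det_fin_two]; exact g.det_coe
  by_cases hc : g 1 0 = 0
  · have had : g 1 1 = g 0 0 := by
      rw [hc] at hdet
      nlinarith [sq_nonneg (g 0 0 - g 1 1)]
    -- `g` acts by `z ↦ z ± b`, whose displacement tends to zero as `z` rises vertically
    let y : ℝ := Real.sqrt ((g 0 1) ^ 2 / (2 * ε) + 1)
    have hy2 : y ^ 2 = (g 0 1) ^ 2 / (2 * ε) + 1 := Real.sq_sqrt (by positivity)
    have hy : 0 < y := Real.sqrt_pos.2 (by positivity)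
    refine ⟨⟨⟨0, y⟩, hy⟩, ?_⟩
    rw [cosh_dist_smul, hc, had]
    simp only [UpperHalfPlane.im, Complex.normSq_apply, Complex.ofReal_zero, zero_mul, sub_self,
      zero_add, zero_sub, Complex.neg_re, Complex.neg_im, Complex.ofReal_re, Complex.ofReal_im,
      add_le_add_iff_left]
    rw [div_le_iff₀ (by positivity), hy2]
    field_simp
    nlinarith
  · -- Write the fixed points as `x ± i √e` with `e ≥ 0` and evaluate at `x + i √(e + δ2)`, where
    -- the quadratic polynomial of `cosh_dist_smul` takes the value `-c * δ2`.
    let δ2 : ℝ := 2 * ε / (g 1 0) ^ 2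
    have hc2 : 0 < (g 1 0) ^ 2 := by positivity
    have hδ2 : 0 < δ2 := by positivity
    let e : ℝ := (4 - (g 0 0 + g 1 1) ^ 2) / (4 * (g 1 0) ^ 2)
    have he : 0 ≤ e := div_nonneg (by linarith) (by positivity)
    let y : ℝ := Real.sqrt (e + δ2)
    have hy2 : y ^ 2 = e + δ2 := Real.sq_sqrt (by positivity)
    have hy : 0 < y := Real.sqrt_pos.2 (by positivity)
    refine ⟨⟨⟨(g 0 0 - g 1 1) / (2 * g 1 0), y⟩, hy⟩, ?_⟩
    have hq : ((g 1 0 : ℝ) * (⟨(g 0 0 - g 1 1) / (2 * g 1 0), y⟩ : ℂ) ^ 2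
        + (g 1 1 - g 0 0) * (⟨(g 0 0 - g 1 1) / (2 * g 1 0), y⟩ : ℂ) - g 0 1 : ℂ) =
        ((-(g 1 0 * δ2) : ℝ) : ℂ) := by
      have hyy : y * y = e + δ2 := by rw [← sq, hy2]
      apply Complex.ext
      · simp [pow_two, hyy]
        simp only [e]
        field_simp
        linear_combination 16 * hdet
      · simp [pow_two]
        field_simp
        ring
    rw [cosh_dist_smul]
    simp only [UpperHalfPlane.im]
    rw [hq, Complex.normSq_ofReal, add_le_add_iff_left, div_le_iff₀ (by positivity), hy2]
    have : -(g 1 0 * δ2) * -(g 1 0 * δ2) = 2 * ε * δ2 := by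
      simp only [δ2]; field_simp
    rw [this]
    nlinarith [mul_nonneg hε.le he]

/-- The imaginary axis of the upper half-plane, parametrized by arc length from `i`. -/
noncomputable def imaginaryAxis (t : ℝ) : ℍ := ⟨⟨0, Real.exp t⟩, Real.exp_pos t⟩

theorem isometry_imaginaryAxis : Isometry imaginaryAxis :=
  UpperHalfPlane.isometry_vertical_line 0

/-- A diagonalizable element translates the image of the imaginary axis under the conjugating matrix,
because `diag (l, l⁻¹)` acts on the axis by multiplication by `l ^ 2`. -/
theorem translatesGeodesicBy_of_mul_eq {g h : SL(2, ℝ)} {l m : ℝ} (hl : 1 < l ^ 2)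
    (hlm : l * m = 1)
    (hgh : (g : Matrix (Fin 2) (Fin 2) ℝ) * h = h * !![l, 0; 0, m]) :
    TranslatesGeodesicBy g (Real.log (l ^ 2)) := by
  let d : SL(2, ℝ) := ⟨!![l, 0; 0, m], by simp [Matrix.det_fin_two, hlm]⟩
  have hd : g * h = h * d := by ext1; simpa using congrFun (congrFun hgh _) _
  have hl0 : l ≠ 0 := left_ne_zero_of_mul_eq_one hlm
  have hm : m = l⁻¹ := (inv_eq_of_mul_eq_one_right hlm).symm
  refine ⟨Real.log_pos hl, fun t => h • imaginaryAxis t,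
    (isometry_smul ℍ h).comp isometry_imaginaryAxis, fun t => ?_⟩
  have hdt : d • imaginaryAxis t = imaginaryAxis (t + Real.log (l ^ 2)) := by
    apply UpperHalfPlane.ext
    rw [UpperHalfPlane.coe_specialLinearGroup_apply]
    have hl0' : (l : ℂ) ≠ 0 := by exact_mod_cast hl0
    simp only [imaginaryAxis, Real.exp_add, Real.exp_log (show 0 < l ^ 2 by positivity)]
    simp [d, hm]
    apply Complex.ext <;> simp [pow_two]
    ring
  simp only
  rw [← mul_smul, hd, mul_smul, hdt]

/-- An element with `|trace| > 2` is hyperbolic. -/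
theorem exists_translatesGeodesicBy {g : SL(2, ℝ)} (hg : 4 < (g 0 0 + g 1 1) ^ 2) :
    ∃ l : ℝ, TranslatesGeodesicBy g l := by
  have hdet : g 0 0 * g 1 1 - g 0 1 * g 1 0 = 1 := by
    rw [← Matrix.det_fin_two]; exact g.det_coe
  -- the eigenvalues, the one of larger modulus first
  obtain ⟨l, m, hlm, hsum, hl⟩ : ∃ l m : ℝ, l * m = 1 ∧ l + m = g 0 0 + g 1 1 ∧ 1 < l ^ 2 := by
    set t := g 0 0 + g 1 1
    let s := Real.sqrt (t ^ 2 - 4)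
    have hs2 : s ^ 2 = t ^ 2 - 4 := Real.sq_sqrt (by linarith)
    have hs : 0 < s := Real.sqrt_pos.2 (by linarith)
    rcases le_total 0 t with ht | ht
    · exact ⟨(t + s) / 2, (t - s) / 2, by nlinarith, by ring, by nlinarith⟩
    · exact ⟨(t - s) / 2, (t + s) / 2, by nlinarith, by ring, by nlinarith⟩
  have hne : l - m ≠ 0 := by
    intro h
    have : m = l := by linarith
    subst this
    nlinarith
  suffices ∃ h : SL(2, ℝ), (g : Matrix (Fin 2) (Fin 2) ℝ) * h = h * !![l, 0; 0, m] by
    obtain ⟨h, hh⟩ := this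
    exact ⟨_, translatesGeodesicBy_of_mul_eq hl hlm hh⟩
  -- it suffices to find eigenvectors `(p, r)`, `(q, s)` for `l`, `m` spanning a unit area
  have main : ∀ p q r s : ℝ, p * s - q * r = 1 →
      g 0 0 * p + g 0 1 * r = l * p → g 0 0 * q + g 0 1 * s = m * q →
      g 1 0 * p + g 1 1 * r = l * r → g 1 0 * q + g 1 1 * s = m * s →
      ∃ h : SL(2, ℝ), (g : Matrix (Fin 2) (Fin 2) ℝ) * h = h * !![l, 0; 0, m] := by
    intro p q r s h1 h2 h3 h4 h5
    refine ⟨⟨!![p, q; r, s], by rw [Matrix.det_fin_two_of, h1]⟩, ?_⟩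
    ext i j
    fin_cases i <;> fin_cases j <;> simp [Matrix.mul_apply, Fin.sum_univ_two] <;> linarith
  by_cases hc : g 1 0 = 0
  · have had : (l - g 0 0) * (l - g 1 1) = 0 := by
      rw [hc] at hdet
      linear_combination hdet - hlm + l * hsum
    rcases mul_eq_zero.1 had with h | h
    · have h0 : g 0 0 = l := by linarith
      have h1 : g 1 1 = m := by linarith
      have hne' : m - l ≠ 0 := fun h => hne (by linarith)
      refine main 1 (g 0 1 / (m - l)) 0 1 (by ring) (by rw [h0]; ring)
        (by rw [h0]; field_simp; ring) (by rw [hc]; ring) (by rw [hc, h1]; ring)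
    · have h0 : g 0 0 = m := by linarith
      have h1 : g 1 1 = l := by linarith
      exact main (g 0 1 / (l - m)) (-1) 1 0 (by ring) (by rw [h0]; field_simp; ring)
        (by rw [h0]; ring) (by rw [hc, h1]; ring) (by rw [hc]; ring)
  · have e1 : g 0 0 = l + m - g 1 1 := by linarith
    refine main (l - g 1 1) ((m - g 1 1) / (g 1 0 * (l - m))) (g 1 0) (1 / (l - m))
      (by field_simp; ring) ?_ ?_ ?_ ?_
    · rw [e1] at hdet ⊢; linear_combination hlm - hdet
    · rw [e1] at hdet ⊢; field_simp; linear_combination hlm - hdet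
    · ring
    · field_simp; ring

/-- Some rotation about `i` moves `w` to the imaginary axis: the numerator `φ θ` of the real part of
the rotated point changes sign when `θ` grows from `0` to `π / 2`. -/
theorem exists_smul_I_eq_and_smul_eq_imaginaryAxis (w : ℍ) :
    ∃ (k : SL(2, ℝ)) (t : ℝ), k • UpperHalfPlane.I = UpperHalfPlane.I ∧
      k • w = imaginaryAxis t := by
  let φ : ℝ → ℝ := fun θ => Real.cos θ * Real.sin θ * (w.re ^ 2 + w.im ^ 2 - 1)
    + (Real.cos θ ^ 2 - Real.sin θ ^ 2) * w.re
  have hφ : Continuous φ := by fun_prop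
  obtain ⟨θ, hθ⟩ : ∃ θ, φ θ = 0 := by
    have h0 : φ 0 = w.re := by simp [φ]
    have h1 : φ (Real.pi / 2) = -w.re := by simp [φ]
    refine mem_range_of_exists_le_of_exists_ge hφ ?_ ?_
    · rcases le_total w.re 0 with h | h
      exacts [⟨0, by linarith⟩, ⟨Real.pi / 2, by linarith⟩]
    · rcases le_total w.re 0 with h | h
      exacts [⟨Real.pi / 2, by linarith⟩, ⟨0, by linarith⟩]
  obtain ⟨c, s, hcs, hre⟩ : ∃ c s : ℝ, s ^ 2 + c ^ 2 = 1 ∧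
      c * s * (w.re ^ 2 + w.im ^ 2 - 1) + (c ^ 2 - s ^ 2) * w.re = 0 :=
    ⟨Real.cos θ, Real.sin θ, Real.sin_sq_add_cos_sq θ, hθ⟩
  let k : SL(2, ℝ) := ⟨!![c, -s; s, c], by rw [Matrix.det_fin_two_of]; linarith⟩
  have hcoe (z : ℍ) : ((k • z : ℍ) : ℂ) = (c * z - s) / (s * z + c) := by
    rw [UpperHalfPlane.coe_specialLinearGroup_apply]
    simp [k, sub_eq_add_neg]
  have hden (z : ℍ) : (s * z + c : ℂ) ≠ 0 := UpperHalfPlane.denom_ne_zero k z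
  refine ⟨k, Real.log (k • w).im, ?_, ?_⟩
  · apply UpperHalfPlane.ext
    rw [hcoe, div_eq_iff (hden _), UpperHalfPlane.coe_I]
    linear_combination -(s : ℂ) * Complex.I_sq
  · apply UpperHalfPlane.ext
    apply Complex.ext
    · rw [hcoe, Complex.div_re]
      simp only [imaginaryAxis]
      rw [← add_div, div_eq_zero_iff]
      left
      simp
      linear_combination hre
    · simp [imaginaryAxis, Real.exp_log (k • w).im_pos]

/-- There is a point at any intermediate distance on the geodesic segment from `i` to `w`. -/
theorem exists_dist_I_eq_sub (w : ℍ) (r : ℝ) (hr : 0 ≤ r) (hrw : r ≤ dist UpperHalfPlane.I w) :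
    ∃ p : ℍ, dist UpperHalfPlane.I p = dist UpperHalfPlane.I w - r ∧ dist p w = r := by
  obtain ⟨k, t, hkI, hkw⟩ := exists_smul_I_eq_and_smul_eq_imaginaryAxis w
  have hI : k • UpperHalfPlane.I = imaginaryAxis 0 := by
    rw [hkI]; apply UpperHalfPlane.ext; simp [imaginaryAxis]; rfl
  have hd : dist UpperHalfPlane.I w = |t| := by
    rw [← dist_smul k, hI, hkw, isometry_imaginaryAxis.dist_eq, Real.dist_eq, zero_sub, abs_neg]
  rw [hd] at hrw ⊢
  obtain ⟨s, hs, hst⟩ : ∃ s : ℝ, |s| = |t| - r ∧ |s - t| = r := by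
    rcases le_total 0 t with ht | ht
    · rw [abs_of_nonneg ht] at *
      exact ⟨t - r, abs_of_nonneg (by linarith),
        by rw [sub_sub_cancel_left, abs_neg, abs_of_nonneg hr]⟩
    · rw [abs_of_nonpos ht] at *
      exact ⟨t + r, by rw [abs_of_nonpos (by linarith)]; ring,
        by rw [add_sub_cancel_left, abs_of_nonneg hr]⟩
  refine ⟨k⁻¹ • imaginaryAxis s, ?_, ?_⟩
  · rw [← dist_smul k, hI, smul_inv_smul, isometry_imaginaryAxis.dist_eq, Real.dist_eq, zero_sub,
      abs_neg, hs]
  · rw [← dist_smul k, hkw, smul_inv_smul, isometry_imaginaryAxis.dist_eq, Real.dist_eq, hst]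

/-! ### Surface groups -/

instance Subgroup.isIsometricSMul_upperHalfPlane (Γ : Subgroup SL(2, ℝ)) :
    IsIsometricSMul Γ ℍ :=
  ⟨fun g => isometry_smul ℍ (g : SL(2, ℝ))⟩

theorem TranslatesGeodesicBy.exists_dist_eq {g : SL(2, ℝ)} {l : ℝ}
    (h : TranslatesGeodesicBy g l) : ∃ z : ℍ, dist z (g • z) = l := by
  obtain ⟨hl, c, hc, hgc⟩ := h
  exact ⟨c 0, by rw [hgc, hc.dist_eq, Real.dist_eq, zero_add, zero_sub, abs_neg, abs_of_pos hl]⟩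

namespace IsClosedHyperbolicSurfaceGroup

variable {Γ : Subgroup SL(2, ℝ)}

theorem exists_displacement_lower_bound (hΓ : IsClosedHyperbolicSurfaceGroup Γ) :
    ∃ ε : ℝ, 0 < ε ∧ ∀ γ : Γ, (γ : SL(2, ℝ)) ≠ 1 → (γ : SL(2, ℝ)) ≠ -1 →
      ∀ z : ℍ, ε ≤ dist z (γ • z) := by
  have := hΓ.discrete
  have := hΓ.compact
  obtain ⟨ε, hε, h⟩ := _root_.exists_displacement_lower_bound (X := ℍ)
    (N := {γ : Γ | (γ : SL(2, ℝ)) = 1 ∨ (γ : SL(2, ℝ)) = -1})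
    -- `1` and `-1` are central, so they are conjugate only to themselves
    (by
      rintro g h (hh | hh) <;> simp only [Subgroup.coe_mul, Subgroup.coe_inv] at hh
      · exact Or.inl (conj_eq_one_iff.1 hh)
      · rw [mul_inv_eq_iff_eq_mul] at hh
        refine Or.inr (mul_left_cancel (a := (g : SL(2, ℝ))) (hh.trans ?_))
        rw [neg_one_mul, mul_neg_one])
    (fun γ z hz => hΓ.free γ γ.2 z hz)
  exact ⟨ε, hε, fun γ h1 h2 => h γ (not_or.2 ⟨h1, h2⟩)⟩

/-- A surface group contains no parabolic or elliptic elements, as these would have points of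
arbitrarily small displacement. -/
theorem exists_translatesGeodesicBy (hΓ : IsClosedHyperbolicSurfaceGroup Γ) (γ : Γ)
    (h1 : (γ : SL(2, ℝ)) ≠ 1) (h2 : (γ : SL(2, ℝ)) ≠ -1) :
    ∃ l : ℝ, TranslatesGeodesicBy γ l := by
  obtain ⟨ε, hε, h⟩ := hΓ.exists_displacement_lower_bound
  refine _root_.exists_translatesGeodesicBy (lt_of_not_ge fun htr => ?_)
  have hcosh : 1 < Real.cosh ε := Real.one_lt_cosh.2 hε.ne'
  obtain ⟨z, hz⟩ := exists_cosh_dist_smul_le htr (half_pos (sub_pos.2 hcosh))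
  have : Real.cosh ε ≤ Real.cosh (dist z ((γ : SL(2, ℝ)) • z)) := by
    rw [Real.cosh_le_cosh, abs_of_pos hε, abs_of_nonneg dist_nonneg]
    exact h γ h1 h2 z
  linarith

end IsClosedHyperbolicSurfaceGroup

theorem proposition9p4 (Γ : Subgroup SL(2, ℝ)) (hΓ : IsClosedHyperbolicSurfaceGroup Γ) :
    Group.FG Γ ∧
    ∀ S : Finset Γ, Subgroup.closure (S : Set Γ) = ⊤ → ∀ M : ℝ,
      ∃ K : ℝ, 0 < K ∧
        ∀ (f : Γ → ℤ) (D : ℝ), IsConjugacyInvariant f →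
          IsQuasimorphismWithDefect (fun γ => (f γ : ℝ)) D →
          (∀ s ∈ S, |(f s : ℝ)| ≤ M) →
          ∀ γ : Γ, (γ : SL(2, ℝ)) ≠ 1 → (γ : SL(2, ℝ)) ≠ -1 →
            |(f γ : ℝ)| ≤ K * (1 + D) * closedGeodesicLength (γ : SL(2, ℝ)) := by
  have := hΓ.discrete
  have := hΓ.compact
  obtain ⟨R, hR, hcov⟩ := exists_cobounded (G := Γ) UpperHalfPlane.I
  have hgeo (y : ℍ) (r : ℝ) (hr : 0 ≤ r) (hry : r ≤ dist UpperHalfPlane.I y) :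
      ∃ p : ℍ, dist UpperHalfPlane.I p ≤ dist UpperHalfPlane.I y - r ∧ dist p y ≤ r := by
    obtain ⟨p, h1, h2⟩ := exists_dist_I_eq_sub y r hr hry
    exact ⟨p, h1.le, h2.le⟩
  have hfin := finite_setOf_dist_le (G := Γ) UpperHalfPlane.I (2 * R + 1)
  refine ⟨⟨⟨hfin.toFinset, by
    rw [Set.Finite.coe_toFinset]; exact closure_dist_le_eq_top hR hcov hgeo⟩⟩, fun S hS M => ?_⟩
  obtain ⟨C, hC, hfC⟩ := exists_quasimorphism_bound_dist hR hcov hgeo hfin hS M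
  obtain ⟨ε, hε, hsys⟩ := hΓ.exists_displacement_lower_bound
  refine ⟨C * (1 + (2 * R + 2) / ε), by positivity, fun f D hconj hf hfS γ h1 h2 => ?_⟩
  have hD := hf.defect_nonneg
  have hpos : 0 < C * (1 + (2 * R + 2) / ε) * (1 + D) := by positivity
  rw [mul_comm, ← div_le_iff₀ hpos]
  -- the set of translation lengths is nonempty, so its infimum is not a junk value
  refine le_csInf (hΓ.exists_translatesGeodesicBy γ h1 h2) fun l hl => ?_
  rw [div_le_iff₀ hpos]
  obtain ⟨z, hz⟩ := hl.exists_dist_eq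
  have hεl : ε ≤ l := hz ▸ hsys γ h1 h2 z
  -- conjugate `γ` so that its axis passes within `R` of the base point
  obtain ⟨g, hg⟩ := hcov z
  have hdist : dist UpperHalfPlane.I ((g⁻¹ * γ * g⁻¹⁻¹) • UpperHalfPlane.I) ≤ l + 2 * R := by
    rw [← dist_smul g, inv_inv, mul_assoc, mul_smul, smul_inv_smul, mul_smul]
    have h3 := dist_triangle4 (g • UpperHalfPlane.I) z (γ • z) (γ • g • UpperHalfPlane.I)
    have h4 : dist z (γ • z) = l := hz
    rw [dist_smul, h4, dist_comm _ z] at h3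
    linarith
  have hbound := hfC _ D hf hfS (g⁻¹ * γ * g⁻¹⁻¹)
  rw [hconj g⁻¹ γ] at hbound
  -- the additive constant is absorbed because `l` is at least the systole bound `ε`
  have hlin : l + 2 * R + 2 ≤ l * (1 + (2 * R + 2) / ε) := by
    have : 2 * R + 2 ≤ l * ((2 * R + 2) / ε) := by
      rw [← mul_div_assoc, le_div_iff₀ hε, mul_comm]
      exact mul_le_mul_of_nonneg_right hεl (by positivity)
    linarith
  calc |(f γ : ℝ)| ≤ C * (1 + D) * (l * (1 + (2 * R + 2) / ε)) :=
        hbound.trans (mul_le_mul_of_nonneg_left (by linarith) (by positivity))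
    _ = l * (C * (1 + (2 * R + 2) / ε) * (1 + D)) := by ring
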